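/- **Definitions.** A group $G=\langle a,b,c\rangle$ is a *triangle-point group* (with respect to $a,b,c$) if $a,b,c$ and $ab$ have order $2$ and, for all $t,s\in a^G\cup b^G\cup c^G\cup (ab)^G$, the product $ts$ has order at most $6$. Let $V$ be a real vector space with an inner product $(\,,\,)$ and a bilinear commutative (not necessarily associative) product $\cdot$ such that (M1) $(u,v\cdot w)=(u\cdot v,w)$ and (M2) $(u\cdot u,v\cdot v)\ge (u\cdot v,u\cdot v)$ for all $u,v,w$. For $x\in V$ put $V^{(x)}_\mu=\{v: x\cdot v=\mu v\}$. A vector $x\in V$ is a *Majorana axis* if: (M3) $(x,x)=1$ and $x\cdot x=x$; (M4) $V=V^{(x)}_1\oplus V^{(x)}_0\oplus V^{(x)}_{1/4}\oplus V^{(x)}_{1/32}$; (M5) $V^{(x)}_1=\mathbb{R}x$; (M6) the linear map $\tau(x)$ of $V$ that is $1$ on $V^{(x)}_1\oplus V^{(x)}_0\oplus V^{(x)}_{1/4}$ and $-1$ on $V^{(x)}_{1/32}$ preserves the product; (M7) the linear map $\sigma(x)$ of $V^{(x)}_+=V^{(x)}_1\oplus V^{(x)}_0\oplus V^{(x)}_{1/4}$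 that is $1$ on $V^{(x)}_1\oplus V^{(x)}_0$ and $-1$ on $V^{(x)}_{1/4}$ preserves the restriction of the product to $V^{(x)}_+$. For Majorana axes $a_0,a_1$, the subalgebra they generate is *of type $2A$ with third axis $a_\rho$* if it has basis $a_0,a_1,a_\rho$, where $a_0,a_1,a_\rho$ are idempotents of length $1$, any two of them have inner product $\tfrac18$, and $x\cdot y=\tfrac18(x+y-z)$ whenever $\{x,y,z\}=\{a_0,a_1,a_\rho\}$. A *Majorana representation* $(G,T,V)$ consists of a finite group $G$, a conjugation-stable set $T$ of involutions generating $G$, a space $V$ with inner product and product as above satisfying (M1) and (M2) and generated as an algebra by a set $A$ of Majorana axes, a linear representation $\varphi:G\to GL(V)$ preserving the inner product and the algebra product, and a bijection $\psi:T\to A$ such that $\psi(gtg^{-1})=\varphi(g)\psi(t)$ and $\varphi(t)=\tau(\psi(t))$ for all $t\in T$, $g\in G$, and such that the following axiom holds. (M8) Let $t_0,t_1\in T$. If $\psi(t_0),\psi(t_1)$ generate a subalgebra of type $2A$ with third axis $a_\rho$, then $t_0t_1\in T$ and $\psi(t_0t_1)=a_\rho$. If $t_2\in T$ and $t_0t_1t_2=1$,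 then $\psi(t_0),\psi(t_1)$ generate a subalgebra of type $2A$ with third axis $\psi(t_2)$. **Proposition.** Let $G=\langle a,b,c\rangle$ be a triangle-point group with $G\cong S_3\times S_3\times S_3$. Then: 1. for every $T\subseteq G$ with $a,b,c,ab\in T$ there is no Majorana representation of the form $(G,T,V)$; 2. the subgroup $K=\langle (ac)^3,(bc)^3,(abc)^3\rangle$ of $G$ is elementary abelian of order $8$; 3. $K\subseteq T\cup\{e\}$ for every conjugation-stable set $T\subseteq G$ that contains $a,b,c,ab$ and contains $(ts)^3$ whenever $t,s\in T$ and $ts$ has order $6$. -/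

import Mathlib

/-- `G = ⟨a, b, c⟩` is a triangle-point group: `a`, `b`, `c`, `ab` have order two, `a, b, c`
generate `G`, and any product of two conjugates of `a`, `b`, `c`, `ab` has (finite) order
at most six. -/
structure IsTrianglePointGroup {G : Type*} [Group G] (a b c : G) : Prop where
  orderOf_a : orderOf a = 2
  orderOf_b : orderOf b = 2
  orderOf_c : orderOf c = 2
  orderOf_ab : orderOf (a * b) = 2
  generate : Subgroup.closure {a, b, c} = ⊤
  orderOf_mul_le : ∀ x ∈ ({a, b, c, a * b} : Set G), ∀ y ∈ ({a, b, c, a * b} : Set G),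
    ∀ t s : G, IsConj x t → IsConj y s → IsOfFinOrder (t * s) ∧ orderOf (t * s) ≤ 6

section Majorana

variable {V : Type*} [NonUnitalNonAssocCommRing V] [Module ℝ V] [IsScalarTower ℝ V V]
  [SMulCommClass ℝ V V]

/-- The `μ`-eigenvectors of the adjoint action `v ↦ a * v` of `a`. -/
noncomputable def majoranaEigenspace (a : V) (μ : ℝ) : Submodule ℝ V :=
  Module.End.eigenspace (LinearMap.mulLeft ℝ a) μ

/-- The sum of the `1`-, `0`- and `1/4`-eigenspaces of `a`. -/
noncomputable def majoranaPlus (a : V) : Submodule ℝ V :=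
  majoranaEigenspace a 1 ⊔ majoranaEigenspace a 0 ⊔ majoranaEigenspace a (1 / 4)

/-- `τ` is the linear map `τ(a)`: the identity on the `1`-, `0`- and `1/4`-eigenvectors of `a`
and minus the identity on the `1/32`-eigenvectors. If `V` is the sum of these four eigenspaces,
there is exactly one such map. -/
structure IsMajoranaTau (a : V) (τ : V →ₗ[ℝ] V) : Prop where
  one : ∀ u ∈ majoranaEigenspace a 1, τ u = u
  zero : ∀ u ∈ majoranaEigenspace a 0, τ u = u
  quarter : ∀ u ∈ majoranaEigenspace a (1 / 4), τ u = u
  thirtysecond : ∀ u ∈ majoranaEigenspace a (1 / 32), τ u = -u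

/-- `σ` is the linear map `σ(a)` of `majoranaPlus a`: the identity on the `1`- and
`0`-eigenvectors of `a` and minus the identity on the `1/4`-eigenvectors. -/
structure IsMajoranaSigma (a : V) (σ : majoranaPlus a →ₗ[ℝ] majoranaPlus a) : Prop where
  one : ∀ u : majoranaPlus a, (u : V) ∈ majoranaEigenspace a 1 → σ u = u
  zero : ∀ u : majoranaPlus a, (u : V) ∈ majoranaEigenspace a 0 → σ u = u
  quarter : ∀ u : majoranaPlus a, (u : V) ∈ majoranaEigenspace a (1 / 4) → σ u = -u

/-- `form` is an inner product on the algebra `V` which associates with the product and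
satisfies the Norton inequality (the axioms M1 and M2). -/
structure IsMajoranaForm (form : LinearMap.BilinForm ℝ V) : Prop where
  symm : ∀ u v : V, form u v = form v u
  pos : ∀ u : V, u ≠ 0 → 0 < form u u
  assoc : ∀ u v w : V, form u (v * w) = form (u * v) w
  norton : ∀ u v : V, form (u * v) (u * v) ≤ form (u * u) (v * v)

/-- `a` is a Majorana axis (the axioms M3 to M7). -/
structure IsMajoranaAxis (form : LinearMap.BilinForm ℝ V) (a : V) : Prop where
  length : form a a = 1
  idempotent : a * a = a
  decomposition : DirectSum.IsInternal
    (fun i : Fin 4 => majoranaEigenspace a ((![1, 0, 1 / 4, 1 / 32] : Fin 4 → ℝ) i))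
  primitive : majoranaEigenspace a 1 = Submodule.span ℝ {a}
  tau : ∃ τ : V →ₗ[ℝ] V, IsMajoranaTau a τ ∧ ∀ u v : V, τ (u * v) = τ u * τ v
  sigma : ∃ σ : majoranaPlus a →ₗ[ℝ] majoranaPlus a, IsMajoranaSigma a σ ∧
    ∀ u v : majoranaPlus a, ∃ w : majoranaPlus a,
      (w : V) = (u : V) * (v : V) ∧ (σ w : V) = (σ u : V) * (σ v : V)

/-- The subalgebra generated by `a₀` and `a₁` is a dihedral algebra of type `2A`, with third
basis vector `r` (usually written `a_ρ`). -/
structure IsDihedral2A (form : LinearMap.BilinForm ℝ V) (a₀ a₁ r : V) : Prop where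
  linearIndependent : LinearIndependent ℝ ![a₀, a₁, r]
  span_eq : (NonUnitalAlgebra.adjoin ℝ {a₀, a₁} : NonUnitalSubalgebra ℝ V).toSubmodule =
    Submodule.span ℝ {a₀, a₁, r}
  mul_00 : a₀ * a₀ = a₀
  mul_11 : a₁ * a₁ = a₁
  mul_rr : r * r = r
  mul_01 : a₀ * a₁ = (1 / 8 : ℝ) • (a₀ + a₁ - r)
  mul_0r : a₀ * r = (1 / 8 : ℝ) • (a₀ + r - a₁)
  mul_1r : a₁ * r = (1 / 8 : ℝ) • (a₁ + r - a₀)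
  form_00 : form a₀ a₀ = 1
  form_11 : form a₁ a₁ = 1
  form_rr : form r r = 1
  form_01 : form a₀ a₁ = 1 / 8
  form_0r : form a₀ r = 1 / 8
  form_1r : form a₁ r = 1 / 8

end Majorana

/-- A Majorana representation `(G, T, V)` satisfying also the axiom M8. The group acts on the
left, so the compatibility of `ψ` with conjugation reads `ψ (g t g⁻¹) = φ(g) ψ(t)`. -/
structure MajoranaRepresentation (G : Type*) [Group G] (T : Set G)
    (V : Type*) [NonUnitalNonAssocCommRing V] [Module ℝ V] [IsScalarTower ℝ V V]
    [SMulCommClass ℝ V V] where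
  finite : Finite G
  orderOf_eq_two : ∀ t ∈ T, orderOf t = 2
  conj_mem : ∀ t ∈ T, ∀ g : G, g * t * g⁻¹ ∈ T
  generate : Subgroup.closure T = ⊤
  /-- The inner product of `V`. -/
  form : LinearMap.BilinForm ℝ V
  isMajoranaForm : IsMajoranaForm form
  /-- The set of Majorana axes. -/
  axes : Set V
  isMajoranaAxis : ∀ a ∈ axes, IsMajoranaAxis form a
  adjoin_axes : (NonUnitalAlgebra.adjoin ℝ axes : NonUnitalSubalgebra ℝ V) = ⊤
  /-- The linear representation of `G` on `V`. -/
  φ : Representation ℝ G V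
  φ_mul : ∀ (g : G) (u v : V), φ g (u * v) = φ g u * φ g v
  φ_form : ∀ (g : G) (u v : V), form (φ g u) (φ g v) = form u v
  /-- The bijection from `T` to the set of Majorana axes. -/
  ψ : T ≃ axes
  ψ_conj : ∀ (t : T) (g : G),
    (ψ ⟨g * t * g⁻¹, conj_mem t t.2 g⟩ : V) = φ g (ψ t : V)
  /-- Every `t ∈ T` acts on `V` as the Majorana involution `τ(ψ(t))`. -/
  φ_eq_tau : ∀ t : T, IsMajoranaTau (ψ t : V) (φ (t : G))
  /-- First half of M8. -/
  mul_mem_of_2A : ∀ (t₀ t₁ : T) (r : V), IsDihedral2A form (ψ t₀ : V) (ψ t₁ : V) r →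
    ∃ h : (t₀ : G) * (t₁ : G) ∈ T, (ψ ⟨(t₀ : G) * (t₁ : G), h⟩ : V) = r
  /-- Second half of M8. -/
  isDihedral2A : ∀ t₀ t₁ t₂ : T, (t₀ : G) * (t₁ : G) * (t₂ : G) = 1 →
    IsDihedral2A form (ψ t₀ : V) (ψ t₁ : V) (ψ t₂ : V)

/-! The seven involutions of `K` are forced into `T`, and no Majorana representation can contain a
subgroup of order eight with all its involutions in `T`.

Group side: in each factor of S₃ × S₃ × S₃ exactly one of `b`, `a`, `a * b` is trivial, and each
case occurs in one factor. So `(a * c) ^ 3`, `(b * c) ^ 3` and `(a * b * c) ^ 3` are the components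
of `c` in the three factors. Their pairwise products are conjugate to `a * b`, `b` and `a`, and
their product is `c` (`IsTrianglePointGroup.relations`). Hence `K` lies in `T ∪ {1}` once the three
cubes lie in `T`.

Algebra side, the cubes (`mul_pow_three_mem`): if `t * s` has order six and its cube is not in `T`,
then M8 excludes type 2A for opposite axes of the dihedral group of order twelve, and opposite axes
have product zero. The fusion rules then give 39/256 as the inner product of two axes in one orbit
of three, but only 13/256 and 1/64 are possible for distinct axes (`form_eq_of_dihedral_three`).

Algebra side, the contradiction (`not_forall_mem_of_elementary_abelian`): with all seven involutions
in `T`, differences of axes give two 1/4-eigenvectors of one axis whose product is a nonzero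
1/4-eigenvector, against the fusion rules. -/

set_option linter.unusedSectionVars false

/-! ### Eigenvectors and fusion rules of a single Majorana axis. -/

section MajoranaAxis

variable {V : Type*} [NonUnitalNonAssocCommRing V] [Module ℝ V] [IsScalarTower ℝ V V]
  [SMulCommClass ℝ V V] {F : LinearMap.BilinForm ℝ V} {a : V} {τ : V →ₗ[ℝ] V}

theorem mem_majoranaEigenspace {u : V} {μ : ℝ} :
    u ∈ majoranaEigenspace a μ ↔ a * u = μ • u := by
  simp [majoranaEigenspace]

theorem IsMajoranaForm.left_mul (hF : IsMajoranaForm F) (u v w : V) :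
    F (u * v) w = F u (v * w) := (hF.assoc u v w).symm

theorem IsMajoranaForm.eq_zero_of_eigenvector (hF : IsMajoranaForm F) {u v : V} {μ ν : ℝ}
    (h : μ ≠ ν) (hu : a * u = μ • u) (hv : a * v = ν • v) : F u v = 0 := by
  have h1 := hF.assoc u a v
  rw [mul_comm u a, hu, hv] at h1
  simp only [map_smul, LinearMap.smul_apply, smul_eq_mul] at h1
  have h2 : (ν - μ) * F u v = 0 := by linarith
  exact (mul_eq_zero.1 h2).resolve_left (sub_ne_zero.2 h.symm)

theorem IsMajoranaAxis.exists_eigenvectors (ha : IsMajoranaAxis F a) (v : V) :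
    ∃ (k : ℝ) (x y z : V), v = k • a + x + y + z ∧ a * x = 0 ∧ a * y = (1 / 4 : ℝ) • y ∧
      a * z = (1 / 32 : ℝ) • z := by
  have h : v ∈ ⨆ i : Fin 4,
      majoranaEigenspace a ((![1, 0, 1 / 4, 1 / 32] : Fin 4 → ℝ) i) := by
    rw [ha.decomposition.submodule_iSup_eq_top]
    trivial
  obtain ⟨f, hf, rfl⟩ := (Submodule.mem_iSup_iff_exists_finsupp _ _).1 h
  have h0 := hf 0
  have h1 := hf 1
  have h2 := hf 2
  have h3 := hf 3
  simp only [Matrix.cons_val] at h0 h1 h2 h3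
  rw [ha.primitive, Submodule.mem_span_singleton] at h0
  obtain ⟨k, hk⟩ := h0
  rw [mem_majoranaEigenspace] at h1 h2 h3
  refine ⟨k, f 1, f 2, f 3, ?_, by simpa using h1, h2, h3⟩
  rw [Finsupp.sum_fintype _ _ (fun _ => rfl), Fin.sum_univ_four, hk]

theorem IsMajoranaAxis.form_eigenvector_eq_zero (hF : IsMajoranaForm F)
    (ha : IsMajoranaAxis F a) {u : V} {μ : ℝ} (hμ : μ ≠ 1) (hu : a * u = μ • u) :
    F a u = 0 :=
  hF.eq_zero_of_eigenvector (a := a) hμ.symm (by rw [ha.idempotent, one_smul]) hu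

theorem IsMajoranaAxis.exists_of_tau_fixed (hF : IsMajoranaForm F) (ha : IsMajoranaAxis F a)
    (hτ : IsMajoranaTau a τ) {v : V} (hv : τ v = v) :
    ∃ x y : V, v = F a v • a + x + y ∧ a * x = 0 ∧ a * y = (1 / 4 : ℝ) • y := by
  obtain ⟨k, x, y, z, rfl, hx, hy, hz⟩ := ha.exists_eigenvectors v
  have e1 : τ a = a := hτ.one a (mem_majoranaEigenspace.2 (by rw [ha.idempotent, one_smul]))
  have e2 : τ x = x := hτ.zero x (mem_majoranaEigenspace.2 (by rw [hx, zero_smul]))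
  have e3 : τ y = y := hτ.quarter y (mem_majoranaEigenspace.2 hy)
  have e4 : τ z = -z := hτ.thirtysecond z (mem_majoranaEigenspace.2 hz)
  simp only [map_add, map_smul, e1, e2, e3, e4] at hv
  have hz0 : z = 0 := by linear_combination (norm := module) (-1 / 2 : ℝ) • hv
  have f2 := ha.form_eigenvector_eq_zero hF (μ := 0) (by norm_num) (by rw [hx, zero_smul])
  have f3 := ha.form_eigenvector_eq_zero hF (by norm_num) hy
  refine ⟨x, y, ?_, hx, hy⟩
  simp [hz0, f2, f3, ha.length]

/-- A fixed vector has no 1/32-part. Multiplication by `a` satisfies X² = X/4 on the 0- and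
1/4-parts, and the last term is the defect 1 - 1/4 on the component along `a`. -/
theorem IsMajoranaAxis.mul_mul_of_tau_fixed (hF : IsMajoranaForm F) (ha : IsMajoranaAxis F a)
    (hτ : IsMajoranaTau a τ) {v : V} (hv : τ v = v) :
    a * (a * v) = (1 / 4 : ℝ) • (a * v) + (3 / 4 * F a v) • a := by
  obtain ⟨x, y, h, hx, hy⟩ := ha.exists_of_tau_fixed hF hτ hv
  have h1 : a * v = F a v • a + (1 / 4 : ℝ) • y := by
    conv_lhs => rw [h]
    simp only [mul_add, mul_smul_comm, ha.idempotent, hx, hy, add_zero]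
  rw [h1]
  simp only [mul_add, mul_smul_comm, ha.idempotent, hy]
  module

theorem mem_majoranaPlus {w : V} : w ∈ majoranaPlus a ↔ ∃ p x y : V,
    w = p + x + y ∧ a * p = p ∧ a * x = 0 ∧ a * y = (1 / 4 : ℝ) • y := by
  simp only [majoranaPlus, Submodule.mem_sup, mem_majoranaEigenspace, one_smul, zero_smul]
  constructor
  · rintro ⟨_, ⟨p, hp, x, hx, rfl⟩, y, hy, rfl⟩
    exact ⟨p, x, y, rfl, hp, hx, hy⟩
  · rintro ⟨p, x, y, rfl, hp, hx, hy⟩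
    exact ⟨_, ⟨p, hp, x, hx, rfl⟩, y, hy, rfl⟩

/-- Both `σ(a)`-eigenvectors `u` and `v` have a product on which `σ(a)` acts accordingly. -/
theorem IsMajoranaAxis.exists_mul_eq (ha : IsMajoranaAxis F a) {u v : V} {μ ν : ℝ}
    (hμ : μ = 0 ∨ μ = 1 / 4) (hν : ν = 0 ∨ ν = 1 / 4)
    (hu : a * u = μ • u) (hv : a * v = ν • v) :
    ∃ p x y : V, u * v = p + x + y ∧ a * p = p ∧ a * x = 0 ∧ a * y = (1 / 4 : ℝ) • y ∧
      (if μ = ν then y = 0 else p + x = 0) := by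
  obtain ⟨s, hs, hmul⟩ := ha.sigma
  have key : ∀ (w : V) (κ : ℝ), κ = 0 ∨ κ = 1 / 4 → a * w = κ • w →
      ∃ h : w ∈ majoranaPlus a, (s ⟨w, h⟩ : V) = if κ = 0 then w else -w := by
    rintro w κ (rfl | rfl) hw
    · refine ⟨mem_majoranaPlus.2 ⟨0, w, 0, by simp, by simp, by simpa using hw, by simp⟩, ?_⟩
      rw [hs.zero _ (mem_majoranaEigenspace.2 hw)]
      simp
    · refine ⟨mem_majoranaPlus.2 ⟨0, 0, w, by simp, by simp, by simp, hw⟩, ?_⟩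
      rw [hs.quarter _ (mem_majoranaEigenspace.2 hw)]
      simp
  obtain ⟨hu1, hu2⟩ := key u μ hμ hu
  obtain ⟨hv1, hv2⟩ := key v ν hν hv
  obtain ⟨w, hw, hsw⟩ := hmul ⟨u, hu1⟩ ⟨v, hv1⟩
  obtain ⟨p, x, y, h, hp, hx, hy⟩ := mem_majoranaPlus.1 w.2
  have hp1 : p ∈ majoranaPlus a := mem_majoranaPlus.2 ⟨p, 0, 0, by simp, hp, by simp, by simp⟩
  obtain ⟨hx1, hx2⟩ := key x 0 (Or.inl rfl) (by rw [hx, zero_smul])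
  obtain ⟨hy1, hy2⟩ := key y (1 / 4) (Or.inr rfl) hy
  have hp2 : (s ⟨p, hp1⟩ : V) = p := by
    rw [hs.one _ (mem_majoranaEigenspace.2 (by rw [hp, one_smul]))]
  have hw' : w = ⟨p, hp1⟩ + ⟨x, hx1⟩ + ⟨y, hy1⟩ := Subtype.ext (by simpa using h)
  have hsw' : (s w : V) = p + x - y := by
    rw [hw', map_add, map_add]
    simp [hp2, hx2, hy2, sub_eq_add_neg]
  refine ⟨p, x, y, by rw [← h, hw], hp, hx, hy, ?_⟩
  rw [hsw', hu2, hv2] at hsw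
  rw [h] at hw
  -- `σ(a)` fixes the product when the eigenvalues agree and negates it otherwise; comparing with
  -- its action on `p + x + y` kills `y` or `p + x`.
  rcases hμ with rfl | rfl <;> rcases hν with rfl | rfl <;> norm_num at hsw ⊢
  · linear_combination (norm := module) (1 / 2 : ℝ) • (hw - hsw)
  · linear_combination (norm := module) (1 / 2 : ℝ) • (hw + hsw)
  · linear_combination (norm := module) (1 / 2 : ℝ) • (hw + hsw)
  · linear_combination (norm := module) (1 / 2 : ℝ) • (hw - hsw)

theorem IsMajoranaAxis.mul_zero_quarter (ha : IsMajoranaAxis F a) {u v : V}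
    (hu : a * u = 0) (hv : a * v = (1 / 4 : ℝ) • v) :
    a * (u * v) = (1 / 4 : ℝ) • (u * v) := by
  obtain ⟨p, x, y, h, hp, hx, hy, h0⟩ := ha.exists_mul_eq (μ := 0) (Or.inl rfl) (Or.inr rfl)
    (by rw [hu, zero_smul]) hv
  rw [if_neg (by norm_num)] at h0
  rw [h, h0, zero_add, hy]

theorem IsMajoranaAxis.mul_same_eigenvalue (hF : IsMajoranaForm F) (ha : IsMajoranaAxis F a)
    {u v : V} {μ : ℝ} (hμ : μ = 0 ∨ μ = 1 / 4) (hu : a * u = μ • u) (hv : a * v = μ • v) :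
    a * (u * v) = F a (u * v) • a := by
  obtain ⟨p, x, y, h, hp, hx, hy, h0⟩ := ha.exists_mul_eq hμ hμ hu hv
  rw [if_pos rfl] at h0
  have hp' : p ∈ majoranaEigenspace a 1 := mem_majoranaEigenspace.2 (by rw [hp, one_smul])
  rw [ha.primitive, Submodule.mem_span_singleton] at hp'
  obtain ⟨k, rfl⟩ := hp'
  have f := ha.form_eigenvector_eq_zero hF (μ := 0) (by norm_num) (by rw [hx, zero_smul])
  rw [h, h0]
  simp [mul_add, hx, hp, f, ha.length]

theorem IsMajoranaAxis.mul_zero_zero (hF : IsMajoranaForm F) (ha : IsMajoranaAxis F a)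
    {u v : V} (hu : a * u = 0) (hv : a * v = 0) : a * (u * v) = 0 := by
  rw [ha.mul_same_eigenvalue hF (μ := 0) (Or.inl rfl) (by rw [hu, zero_smul])
    (by rw [hv, zero_smul]), hF.assoc, hu]
  simp

/-- Multiplications by `a` and by an element annihilated by `a` commute on the fixed space of
`τ(a)`. -/
theorem IsMajoranaAxis.mul_left_comm_of_mul_eq_zero (hF : IsMajoranaForm F)
    (ha : IsMajoranaAxis F a) (hτ : IsMajoranaTau a τ) {u v : V} (hu : a * u = 0)
    (hv : τ v = v) : a * (u * v) = u * (a * v) := by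
  obtain ⟨x, y, h, hx, hy⟩ := ha.exists_of_tau_fixed hF hτ hv
  rw [h]
  have e1 := ha.mul_zero_zero hF hu hx
  have e2 := ha.mul_zero_quarter hu hy
  have e3 : u * a = 0 := by rw [mul_comm, hu]
  simp only [mul_add, mul_smul_comm, e1, e2, e3, hx, hy, ha.idempotent, mul_zero, smul_zero]

/-- The resurrection principle for the difference of the squares of the `0`-part and the
`1/4`-part of a vector. -/
theorem IsMajoranaAxis.mul_sub_mul_add (hF : IsMajoranaForm F) (ha : IsMajoranaAxis F a)
    (hτ : IsMajoranaTau a τ) {v : V} (hv : τ v = v) :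
    ∃ k : ℝ, a * ((v - (8 : ℝ) • (a * v) + (7 * F a v) • a) * (v - F a v • a)) = k • a := by
  obtain ⟨x, y, h, hx, hy⟩ := ha.exists_of_tau_fixed hF hτ hv
  have h1 : a * v = F a v • a + (1 / 4 : ℝ) • y := by
    conv_lhs => rw [h]
    simp only [mul_add, mul_smul_comm, ha.idempotent, hx, hy, add_zero]
  -- Subtracting `8 • (a * v)` turns `y` into `-y` and leaves `-7 * F a v` along `a`, which the last
  -- term cancels.
  have e1 : v - (8 : ℝ) • (a * v) + (7 * F a v) • a = x - y := by
    linear_combination (norm := module) h - (8 : ℝ) • h1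
  have e2 : v - F a v • a = x + y := by linear_combination (norm := module) h
  have e3 : (x - y) * (x + y) = x * x - y * y := by
    rw [sub_mul, mul_add, mul_add, mul_comm y x]
    abel
  refine ⟨-F a (y * y), ?_⟩
  rw [e1, e2, e3, mul_sub, ha.mul_zero_zero hF hx hx,
    ha.mul_same_eigenvalue hF (Or.inr rfl) hy hy, zero_sub, neg_smul]

/-- `τ` negates `u - v`, so only its 1/32-part survives. -/
theorem IsMajoranaAxis.mul_sub_of_tau_swap (ha : IsMajoranaAxis F a)
    (hτ : IsMajoranaTau a τ) {u v : V} (huv : τ u = v) (hvu : τ v = u) :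
    a * (u - v) = (1 / 32 : ℝ) • (u - v) := by
  obtain ⟨k, x, y, z, h, hx, hy, hz⟩ := ha.exists_eigenvectors (u - v)
  have e1 : τ a = a := hτ.one a (mem_majoranaEigenspace.2 (by rw [ha.idempotent, one_smul]))
  have e2 : τ x = x := hτ.zero x (mem_majoranaEigenspace.2 (by rw [hx, zero_smul]))
  have e3 : τ y = y := hτ.quarter y (mem_majoranaEigenspace.2 hy)
  have e4 : τ z = -z := hτ.thirtysecond z (mem_majoranaEigenspace.2 hz)
  have h1 := congrArg τ h
  simp only [map_add, map_sub, map_smul, e1, e2, e3, e4, huv, hvu] at h1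
  have h2 : u - v = z := by linear_combination (norm := module) (1 / 2 : ℝ) • (h - h1)
  rw [h2, hz]

end MajoranaAxis

/-! ### Two axes fixed by each other's involutions: product zero or type 2A. -/

section Dihedral

variable {V : Type*} [NonUnitalNonAssocCommRing V] [Module ℝ V] [IsScalarTower ℝ V V]
  [SMulCommClass ℝ V V] {F : LinearMap.BilinForm ℝ V} {a b : V} {τ τ' : V →ₗ[ℝ] V}

theorem IsMajoranaAxis.form_ne_one (hF : IsMajoranaForm F) (ha : IsMajoranaAxis F a)
    (hb : IsMajoranaAxis F b) (hab : a ≠ b) : F a b ≠ 1 := by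
  intro h
  have h1 := hF.pos (a - b) (sub_ne_zero.2 hab)
  simp only [map_sub, LinearMap.sub_apply, ha.length, hb.length, hF.symm b a, h] at h1
  norm_num at h1

theorem IsMajoranaForm.form_self_mul (hF : IsMajoranaForm F) (ha : a * a = a) (v : V) :
    F a (a * v) = F a v := by rw [hF.assoc, ha]

/-- If `b` is fixed by `τ(a)`, then `b - 2y` is an idempotent, where `y` is the `1/4`-part of `b`. -/
theorem IsMajoranaAxis.sigma_image_idempotent (hF : IsMajoranaForm F) (ha : IsMajoranaAxis F a)
    (hτ : IsMajoranaTau a τ) (hb : b * b = b) (hab : τ b = b) :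
    (b - (8 : ℝ) • (a * b) + (8 * F a b) • a) * (b - (8 : ℝ) • (a * b) + (8 * F a b) • a) =
      b - (8 : ℝ) • (a * b) + (8 * F a b) • a := by
  obtain ⟨x, y, h, hx, hy⟩ := ha.exists_of_tau_fixed hF hτ hab
  set L := F a b
  have h1 : a * b = L • a + (1 / 4 : ℝ) • y := by
    rw [h]
    simp only [mul_add, mul_smul_comm, ha.idempotent, hx, hy, add_zero]
  have e1 : b - (8 : ℝ) • (a * b) + (8 * L) • a = L • a + x - y := by
    linear_combination (norm := module) h - (8 : ℝ) • h1
  have hxx := ha.mul_zero_zero hF hx hx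
  have hxy := ha.mul_zero_quarter hx hy
  have hyy := ha.mul_same_eigenvalue hF (Or.inr rfl) hy hy
  have fy := ha.form_eigenvector_eq_zero hF (by norm_num) hy
  have fxy := ha.form_eigenvector_eq_zero hF (by norm_num) hxy
  have ebb : b = (L ^ 2) • a + x * x + y * y + (2 : ℝ) • (x * y) + (L / 2) • y := by
    conv_lhs => rw [← hb, h]
    simp only [mul_add, add_mul, mul_smul_comm, smul_mul_assoc, ha.idempotent, mul_comm x a,
      mul_comm y a, mul_comm y x, hx, hy]
    module
  have err : (L • a + x - y) * (L • a + x - y) =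
      (L ^ 2) • a + x * x + y * y - (2 : ℝ) • (x * y) - (L / 2) • y := by
    simp only [mul_add, add_mul, mul_sub, sub_mul, mul_smul_comm, smul_mul_assoc,
      ha.idempotent, mul_comm x a, mul_comm y a, mul_comm y x, hx, hy]
    module
  have h2 := congrArg (a * ·) ebb
  simp only [mul_add, mul_smul_comm, ha.idempotent, hxx, hxy, hyy, hy, h1] at h2
  have h3 := congrArg (F a) h2
  simp only [map_add, map_smul, map_zero, ha.length, fy, fxy, smul_eq_mul] at h3
  -- The 1/4-part of the equation `b * b = b`. Changing its sign turns the expansion of `b * b` into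
  -- that of the square of `b - 2y`.
  have h4 : y = (2 : ℝ) • (x * y) + (L / 2) • y := by
    have h5 : F a (y * y) = L - L ^ 2 := by linarith
    rw [h5] at h2
    linear_combination (norm := module) (4 : ℝ) • h2
  rw [e1, err]
  linear_combination (norm := module) -ebb + h + (2 : ℝ) • h4

/-- The subalgebra generated by two axes fixed by each other's Majorana involution is of type
`2B` (or `1A`) or `2A`. -/
theorem IsMajoranaAxis.mul_eq_zero_or_isDihedral2A (hF : IsMajoranaForm F)
    (ha : IsMajoranaAxis F a) (hb : IsMajoranaAxis F b) (hne : a ≠ b)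
    (hτ : IsMajoranaTau a τ) (hτ' : IsMajoranaTau b τ') (hab : τ b = b) (hba : τ' a = a) :
    a * b = 0 ∨ IsDihedral2A F a b (a + b - (8 : ℝ) • (a * b)) := by
  have haab := ha.mul_mul_of_tau_fixed hF hτ hab
  have hbab := hb.mul_mul_of_tau_fixed hF hτ' hba
  have hL : F b a = F a b := hF.symm b a
  have hr := ha.sigma_image_idempotent hF hτ hb.idempotent hab
  obtain ⟨k, hk⟩ := ha.mul_sub_mul_add hF hτ hab
  have faab := hF.form_self_mul ha.idempotent b
  have fbab : F b (a * b) = F a b := by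
    rw [mul_comm a b, hF.form_self_mul hb.idempotent, hL]
  rw [hL, mul_comm b a] at hbab
  set L := F a b
  have hexp : (b - (8 : ℝ) • (a * b) + (7 * L) • a) * (b - L • a) =
      (1 - 6 * L) • b + (8 * L - 2) • (a * b) - (L ^ 2) • a := by
    simp only [add_mul, mul_sub, sub_mul, mul_smul_comm, smul_mul_assoc,
      ha.idempotent, hb.idempotent, mul_comm b a, mul_comm (a * b) a, mul_comm (a * b) b,
      haab, hbab]
    module
  rw [hexp] at hk
  simp only [mul_add, mul_sub, mul_smul_comm, haab, ha.idempotent] at hk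
  -- The resurrection identity makes `a * b` a multiple of `a`, unless the coefficient vanishes at
  -- `L = 1 / 8`, the 2A value.
  have hk' : (1 / 2 - 4 * L) • (a * b) = (k + L ^ 2 - (8 * L - 2) * (3 / 4 * L)) • a := by
    linear_combination (norm := module) hk
  by_cases h8 : L = 1 / 8
  · right
    -- At `L = 1 / 8` the candidate third axis is the `σ(a)`-image of `b`, hence idempotent.
    have hr' : b - (8 : ℝ) • (a * b) + (8 * L) • a = a + b - (8 : ℝ) • (a * b) := by
      rw [h8]; module
    rw [hr'] at hr
    have hFL : F a b = 1 / 8 := h8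
    rw [h8] at haab hbab hL faab fbab
    have f1 : F (a * b) a = 1 / 8 := by rw [hF.symm, faab]
    have f2 : F (a * b) b = 1 / 8 := by rw [hF.symm, fbab]
    have f3 : F (a * b) (a * b) = 11 / 256 := by
      rw [hF.left_mul, hbab]
      simp only [map_add, map_smul, smul_eq_mul, faab, hFL]
      norm_num
    have far : F a (a + b - (8 : ℝ) • (a * b)) = 1 / 8 := by
      simp only [map_add, map_sub, map_smul, smul_eq_mul, ha.length, hFL, faab]
      norm_num
    have fbr : F b (a + b - (8 : ℝ) • (a * b)) = 1 / 8 := by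
      simp only [map_add, map_sub, map_smul, smul_eq_mul, hb.length, hL, fbab]
      norm_num
    have frr : F (a + b - (8 : ℝ) • (a * b)) (a + b - (8 : ℝ) • (a * b)) = 1 := by
      simp only [map_add, map_sub, map_smul, LinearMap.add_apply, LinearMap.sub_apply,
        LinearMap.smul_apply, smul_eq_mul, ha.length, hb.length, hL, hFL, faab, fbab, f1, f2, f3]
      norm_num
    have har : a * (a + b - (8 : ℝ) • (a * b)) =
        (1 / 8 : ℝ) • (a + (a + b - (8 : ℝ) • (a * b)) - b) := by
      simp only [mul_add, mul_sub, mul_smul_comm, haab, ha.idempotent]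
      module
    have hbr : b * (a + b - (8 : ℝ) • (a * b)) =
        (1 / 8 : ℝ) • (b + (a + b - (8 : ℝ) • (a * b)) - a) := by
      simp only [mul_add, mul_sub, mul_smul_comm, hbab, hb.idempotent, mul_comm b a]
      module
    have habr : a * b = (1 / 8 : ℝ) • (a + b - (a + b - (8 : ℝ) • (a * b))) := by module
    have hmem : a + b - (8 : ℝ) • (a * b) ∈
        (NonUnitalAlgebra.adjoin ℝ {a, b} : NonUnitalSubalgebra ℝ V) := by
      have h1 : a ∈ (NonUnitalAlgebra.adjoin ℝ {a, b} : NonUnitalSubalgebra ℝ V) :=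
        NonUnitalAlgebra.subset_adjoin ℝ (by simp)
      have h2 : b ∈ (NonUnitalAlgebra.adjoin ℝ {a, b} : NonUnitalSubalgebra ℝ V) :=
        NonUnitalAlgebra.subset_adjoin ℝ (by simp)
      exact sub_mem (add_mem h1 h2) (SMulMemClass.smul_mem _ (mul_mem h1 h2))
    generalize a + b - (8 : ℝ) • (a * b) = r at *
    refine ⟨?_, ?_, ha.idempotent, hb.idempotent, hr, habr, har, hbr, ha.length, hb.length, frr,
      hFL, far, fbr⟩
    · rw [Fintype.linearIndependent_iff]
      intro g hg
      simp only [Fin.sum_univ_three, Matrix.cons_val] at hg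
      have g1 := congrArg (F a) hg
      have g2 := congrArg (F b) hg
      have g3 := congrArg (F r) hg
      simp only [map_add, map_smul, map_zero, smul_eq_mul, ha.length, hb.length, hL, hFL, far,
        fbr, frr, hF.symm r a, hF.symm r b] at g1 g2 g3
      intro i
      fin_cases i <;> simp only [Fin.reduceFinMk, Fin.zero_eta, Fin.mk_one] <;> linarith
    · apply le_antisymm
      · intro v hv
        rw [NonUnitalSubalgebra.mem_toSubmodule] at hv
        have hle : ({a, b} : Set V) ⊆ Submodule.span ℝ {a, b, r} := by
          rintro w (rfl | rfl) <;> exact Submodule.subset_span (by simp)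
        induction hv using NonUnitalAlgebra.adjoin_induction with
        | mem x hx => exact hle hx
        | add x y _ _ hx hy => exact add_mem hx hy
        | zero => exact zero_mem _
        | smul k x _ hx => exact Submodule.smul_mem _ k hx
        | mul x y _ _ hx hy =>
          obtain ⟨x1, x2, x3, rfl⟩ := Submodule.mem_span_triple.1 hx
          obtain ⟨y1, y2, y3, rfl⟩ := Submodule.mem_span_triple.1 hy
          have ea : a ∈ Submodule.span ℝ {a, b, r} := Submodule.subset_span (by simp)
          have eb : b ∈ Submodule.span ℝ {a, b, r} := Submodule.subset_span (by simp)
          have er : r ∈ Submodule.span ℝ {a, b, r} := Submodule.subset_span (by simp)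
          have eab : a * b ∈ Submodule.span ℝ {a, b, r} :=
            habr ▸ Submodule.smul_mem _ _ (sub_mem (add_mem ea eb) er)
          have ear : a * r ∈ Submodule.span ℝ {a, b, r} :=
            har ▸ Submodule.smul_mem _ _ (sub_mem (add_mem ea er) eb)
          have ebr : b * r ∈ Submodule.span ℝ {a, b, r} :=
            hbr ▸ Submodule.smul_mem _ _ (sub_mem (add_mem eb er) ea)
          simp only [add_mul, mul_add, smul_mul_assoc, mul_smul_comm, ha.idempotent,
            hb.idempotent, hr, mul_comm b a, mul_comm r a, mul_comm r b]
          have sm := fun (k : ℝ) (v : V) (h : v ∈ Submodule.span ℝ {a, b, r}) =>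
            Submodule.smul_mem _ k h
          repeat' first | assumption | apply add_mem | apply sm
      · rw [Submodule.span_le]
        rintro v (rfl | rfl | rfl)
        · exact NonUnitalAlgebra.subset_adjoin ℝ (by simp)
        · exact NonUnitalAlgebra.subset_adjoin ℝ (by simp)
        · exact hmem
  · left
    have h0 : (1 / 2 - 4 * L) ≠ 0 := fun h => h8 (by linarith)
    set m := k + L ^ 2 - (8 * L - 2) * (3 / 4 * L)
    have hm : a * b = (m / (1 / 2 - 4 * L)) • a := by
      rw [div_eq_inv_mul, mul_smul, ← hk', smul_smul, inv_mul_cancel₀ h0, one_smul]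
    set n := m / (1 / 2 - 4 * L)
    -- Pairing `a * b = n • a` with `a` and with `b` gives `n = L` and `n * L = L`; since `L ≠ 1`,
    -- `n = 0`.
    rw [hm, map_smul, smul_eq_mul, ha.length] at faab
    rw [hm, map_smul, smul_eq_mul, hL, ← faab] at fbab
    have hL1 : L ≠ 1 := ha.form_ne_one hF hb hne
    have h2 : n * (L - 1) = 0 := by rw [← faab]; linarith
    rw [hm, (mul_eq_zero.1 h2).resolve_right (sub_ne_zero.2 hL1), zero_smul]

end Dihedral

/-! ### Dihedral groups of order six and twelve. -/

section DihedralHigher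

variable {V : Type*} [NonUnitalNonAssocCommRing V] [Module ℝ V] [IsScalarTower ℝ V V]
  [SMulCommClass ℝ V V] {F : LinearMap.BilinForm ℝ V} {τ : V →ₗ[ℝ] V}

/-- If `a * s = 2 • (w + (1 / 32) • a) + (1 / 32) • s` for a vector `s` fixed by `τ(a)`, then
`a * w` is a combination of `a`, `s` and `w`. -/
theorem IsMajoranaAxis.mul_sigma {a s w : V} {L : ℝ} (hF : IsMajoranaForm F)
    (ha : IsMajoranaAxis F a) (hτ : IsMajoranaTau a τ) (hs : τ s = s)
    (has : a * s = (1 / 16 : ℝ) • a + (1 / 32 : ℝ) • s + (2 : ℝ) • w) (fs : F a s = 2 * L) :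
    a * w = (3 / 4 * L - 25 / 1024) • a + (7 / 2048 : ℝ) • s + (7 / 32 : ℝ) • w := by
  have h := ha.mul_mul_of_tau_fixed hF hτ hs
  simp only [has, mul_add, mul_smul_comm, fs, ha.idempotent] at h
  linear_combination (norm := module) (1 / 2 : ℝ) • h

/-- The possible inner products of the axes of a dihedral algebra of type `3A` or `3C`. -/
theorem form_eq_of_dihedral_three {a b c : V} {L : ℝ} {τb τc : V →ₗ[ℝ] V}
    (hF : IsMajoranaForm F) (ha : IsMajoranaAxis F a) (hb : IsMajoranaAxis F b)
    (hc : IsMajoranaAxis F c) (hτ : IsMajoranaTau a τ) (hτb : IsMajoranaTau b τb)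
    (hτc : IsMajoranaTau c τc) (habc : τ b = c) (hacb : τ c = b) (hbca : τb c = a)
    (hbac : τb a = c) (hcab : τc a = b) (hcba : τc b = a)
    (fab : F a b = L) (fac : F a c = L) (fbc : F b c = L) :
    L = 13 / 256 ∨ L = 1 / 64 ∨ L = 1 := by
  have fba : F b a = L := by rw [hF.symm, fab]
  have fca : F c a = L := by rw [hF.symm, fac]
  have fcb : F c b = L := by rw [hF.symm, fbc]
  -- The swap relations show that this corrected product is the same for all three pairs of axes.
  obtain ⟨w, hw⟩ : ∃ w, w = a * b - (1 / 32 : ℝ) • (a + b) := ⟨_, rfl⟩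
  have h1 := ha.mul_sub_of_tau_swap hτ habc hacb
  have h2 := hb.mul_sub_of_tau_swap hτb hbca hbac
  rw [mul_sub, mul_comm b a] at h2
  rw [mul_sub] at h1
  have hab : a * b = w + (1 / 32 : ℝ) • (a + b) := by rw [hw]; module
  have hac : a * c = w + (1 / 32 : ℝ) • (a + c) := by
    linear_combination (norm := module) -h1 + hab
  have hbc : b * c = w + (1 / 32 : ℝ) • (b + c) := by
    linear_combination (norm := module) h2 + hab
  have hfix : τ (b + c) = b + c := by rw [map_add, habc, hacb, add_comm]
  have hs : F a (b + c) = 2 * L := by rw [map_add, fab, fac]; ring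
  have has : a * (b + c) = (1 / 16 : ℝ) • a + (1 / 32 : ℝ) • (b + c) + (2 : ℝ) • w := by
    rw [mul_add, hab, hac]; module
  have haw := ha.mul_sigma hF hτ hfix has hs
  have hbw := hb.mul_sigma (s := a + c) (w := w) (L := L) hF hτb
    (by rw [map_add, hbac, hbca, add_comm])
    (by rw [mul_add, mul_comm b a, hab, hbc]; module) (by rw [map_add, fba, fbc]; ring)
  have hcw := hc.mul_sigma (s := a + b) (w := w) (L := L) hF hτc
    (by rw [map_add, hcab, hcba, add_comm])
    (by rw [mul_add, mul_comm c a, mul_comm c b, hac, hbc]; module)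
    (by rw [map_add, fca, fcb]; ring)
  obtain ⟨k, hk⟩ := ha.mul_sub_mul_add hF hτ hfix
  have faw : F a w = 31 / 32 * L - 1 / 32 := by
    rw [hw, map_sub, map_smul, map_add, hF.form_self_mul ha.idempotent, fab, ha.length,
      smul_eq_mul]
    ring
  have fbw : F b w = 31 / 32 * L - 1 / 32 := by
    rw [hw, map_sub, map_smul, map_add, mul_comm a b, hF.form_self_mul hb.idempotent, fba,
      hb.length, smul_eq_mul]
    ring
  have hss : (b + c) * (b + c) = (17 / 16 : ℝ) • (b + c) + (2 : ℝ) • w := by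
    simp only [mul_add, add_mul, hb.idempotent, hc.idempotent, mul_comm c b, hbc]
    module
  have hws : w * (b + c) =
      (7 / 1024 : ℝ) • a + (3 / 4 * L - 43 / 2048) • (b + c) + (7 / 16 : ℝ) • w := by
    rw [mul_add, mul_comm w b, mul_comm w c, hbw, hcw]; module
  have fbs : F b (b + c) = 1 + L := by rw [map_add, hb.length, fbc]
  generalize b + c = s at *
  have hX : (s - (8 : ℝ) • (a * s) + (7 * (2 * L)) • a) * (s - (2 * L) • a) =
      (-9 / 64 + L - 4 * L ^ 2) • a + (143 / 128 - 23 / 2 * L) • s + (32 * L - 13 / 2) • w := by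
    rw [has]
    simp only [mul_sub, sub_mul, add_mul, mul_smul_comm, smul_mul_assoc, mul_comm s a,
      mul_comm w a, haw, has, hss, hws, ha.idempotent]
    module
  rw [hs, hX] at hk
  simp only [mul_add, mul_smul_comm, has, haw, ha.idempotent] at hk
  have e1 := congrArg (F a) hk
  have e2 := congrArg (F b) hk
  simp only [map_add, map_smul, smul_eq_mul, ha.length, fba, faw, fbw, hs, fbs] at e1 e2
  -- Pairing the resurrection identity with `a` and `b` and eliminating `k` leaves a cubic in `L`.
  have h0 : (256 * L - 13) * ((64 * L - 1) * (L - 1)) = 0 := by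
    linear_combination 1024 * (e2 - L * e1)
  rcases mul_eq_zero.1 h0 with h | h
  · left; linarith
  · rcases mul_eq_zero.1 h with h | h
    · right; left; linarith
    · right; right; linarith

/-- A relation in the algebra generated by a dihedral group of order twelve whose opposite axes
`c` and `y` have product zero; `s` and `u` are the sums of the other two axes in the orbits of `c`
and `y`. -/
theorem IsMajoranaAxis.sigma_sub_sigma {c y s u w k r : V} {τ' : V →ₗ[ℝ] V} {L : ℝ}
    (hF : IsMajoranaForm F) (hc : IsMajoranaAxis F c) (hy : IsMajoranaAxis F y)
    (hτ : IsMajoranaTau c τ) (hτ' : IsMajoranaTau y τ') (hmul : ∀ v v', τ (v * v') = τ v * τ v')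
    (hτy : τ y = y) (hτu : τ u = u) (hτs : τ' s = s) (hcy : c * y = 0)
    (hcu : c * u = (1 / 16 : ℝ) • c + (1 / 32 : ℝ) • u + (2 : ℝ) • w)
    (hcs : c * s = (1 / 16 : ℝ) • c + (1 / 32 : ℝ) • s + (2 : ℝ) • k)
    (hyu : y * u = (1 / 16 : ℝ) • y + (1 / 32 : ℝ) • u + (2 : ℝ) • r)
    (hys : y * s = (1 / 16 : ℝ) • y + (1 / 32 : ℝ) • s + (2 : ℝ) • w)
    (fcu : F c u = 2 * L) (fys : F y s = 2 * L) :
    k - r = (3 / 32 : ℝ) • (s - u) + (24 * L - 3 / 4) • (y - c) := by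
  have hcw := hc.mul_sigma hF hτ hτu hcu fcu
  have hyw := hy.mul_sigma hF hτ' hτs hys fys
  have hyc : y * c = 0 := by rw [mul_comm, hcy]
  -- Since `c * y = 0`, multiplications by `c` and `y` commute on `u`. This determines `c * r`, and
  -- then `c * (c * (y * u))` can be evaluated in two ways.
  have h1 := hc.mul_left_comm_of_mul_eq_zero hF hτ hcy hτu
  have h2 := hc.mul_mul_of_tau_fixed hF hτ (v := y * u) (by rw [hmul, hτy, hτu])
  have f0 : F c (y * u) = 0 := by rw [hF.assoc, hcy]; simp
  have h3 : y * (c * u) = (1 / 32 : ℝ) • ((1 / 16 : ℝ) • y + (1 / 32 : ℝ) • u + (2 : ℝ) • r) +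
      (2 : ℝ) • ((3 / 4 * L - 25 / 1024) • y + (7 / 2048 : ℝ) • s + (7 / 32 : ℝ) • w) := by
    rw [hcu, mul_add, mul_add, mul_smul_comm, mul_smul_comm, mul_smul_comm, hyc, hyu, hyw]
    module
  have h4 : c * r = (1 / 2 : ℝ) • (y * (c * u)) -
      (1 / 64 : ℝ) • ((1 / 16 : ℝ) • c + (1 / 32 : ℝ) • u + (2 : ℝ) • w) := by
    rw [← h1, hyu, mul_add, mul_add, mul_smul_comm, mul_smul_comm, mul_smul_comm, hcy, hcu]
    module
  rw [h3] at h4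
  rw [f0, h1, h3] at h2
  simp only [mul_add, mul_smul_comm, hcy, hcu, hcs, hcw, h4] at h2
  -- `k` enters only through `c * s`, with coefficient 7/512.
  linear_combination (norm := module) (512 / 7 : ℝ) • h2

/-- A dihedral group of order twelve has no opposite axes `c i` and `y i` with product zero. -/
theorem not_mul_eq_zero_of_dihedral_six {c y : ZMod 3 → V} {τ τ' : ZMod 3 → V →ₗ[ℝ] V}
    (hF : IsMajoranaForm F) (hc : ∀ i, IsMajoranaAxis F (c i))
    (hy : ∀ i, IsMajoranaAxis F (y i)) (hτ : ∀ i, IsMajoranaTau (c i) (τ i))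
    (hτ' : ∀ i, IsMajoranaTau (y i) (τ' i)) (hmul : ∀ i v v', τ i (v * v') = τ i v * τ i v')
    (hform : ∀ i v v', F (τ i v) (τ i v') = F v v')
    (hcc : ∀ i j, τ i (c j) = c (-i - j)) (hcy : ∀ i j, τ i (y j) = y (-i - j))
    (hyc : ∀ i j, τ' i (c j) = c (-i - j)) (hyy : ∀ i j, τ' i (y j) = y (-i - j))
    (hne : c 0 ≠ c 1) (h0 : ∀ i, c i * y i = 0) : False := by
  have fcc (i j k : ZMod 3) : F (c (-i - j)) (c (-i - k)) = F (c j) (c k) := by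
    rw [← hcc, ← hcc, hform]
  have fcy (i j k : ZMod 3) : F (c (-i - j)) (y (-i - k)) = F (c j) (y k) := by
    rw [← hcc, ← hcy, hform]
  have swapc (i j : ZMod 3) : c i * (c j - c (-i - j)) = (1 / 32 : ℝ) • (c j - c (-i - j)) :=
    (hc i).mul_sub_of_tau_swap (hτ i) (hcc i j) (by rw [hcc]; congr 1; abel)
  have swapcy (i j : ZMod 3) : c i * (y j - y (-i - j)) = (1 / 32 : ℝ) • (y j - y (-i - j)) :=
    (hc i).mul_sub_of_tau_swap (hτ i) (hcy i j) (by rw [hcy]; congr 1; abel)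
  have swapyc (i j : ZMod 3) : y i * (c j - c (-i - j)) = (1 / 32 : ℝ) • (c j - c (-i - j)) :=
    (hy i).mul_sub_of_tau_swap (hτ' i) (hyc i j) (by rw [hyc]; congr 1; abel)
  have swapy (i j : ZMod 3) : y i * (y j - y (-i - j)) = (1 / 32 : ℝ) • (y j - y (-i - j)) :=
    (hy i).mul_sub_of_tau_swap (hτ' i) (hyy i j) (by rw [hyy]; congr 1; abel)
  have c02 : F (c 0) (c 2) = F (c 0) (c 1) := fcc 0 0 1
  have c12 : F (c 1) (c 2) = F (c 0) (c 1) := (hF.symm _ _).trans (fcc 1 0 1)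
  have l02 : F (c 0) (y 2) = F (c 0) (y 1) := fcy 0 0 1
  have l21 : F (c 2) (y 1) = F (c 0) (y 1) := fcy 1 0 1
  have l10 : F (c 1) (y 0) = F (c 0) (y 1) := fcy 2 0 1
  have l20 : F (c 2) (y 0) = F (c 0) (y 1) := (fcy 0 1 0).trans l10
  have l12 : F (c 1) (y 2) = F (c 0) (y 1) := (fcy 1 1 0).trans l10
  -- One `w` serves all mixed pairs `c i`, `y j` with `i ≠ j`, while `k` and `r` serve the two
  -- orbits separately.
  obtain ⟨w, hw⟩ : ∃ w, w = c 0 * y 1 - (1 / 32 : ℝ) • (c 0 + y 1) := ⟨_, rfl⟩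
  obtain ⟨k, hk⟩ : ∃ k, k = c 0 * c 1 - (1 / 32 : ℝ) • (c 0 + c 1) := ⟨_, rfl⟩
  obtain ⟨r, hr⟩ : ∃ r, r = y 0 * y 1 - (1 / 32 : ℝ) • (y 0 + y 1) := ⟨_, rfl⟩
  have s1 : c 0 * (y 1 - y 2) = (1 / 32 : ℝ) • (y 1 - y 2) := swapcy 0 1
  have s2 : y 2 * (c 0 - c 1) = (1 / 32 : ℝ) • (c 0 - c 1) := swapyc 2 0
  have s3 : c 1 * (y 2 - y 0) = (1 / 32 : ℝ) • (y 2 - y 0) := swapcy 1 2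
  have s4 : y 0 * (c 1 - c 2) = (1 / 32 : ℝ) • (c 1 - c 2) := swapyc 0 1
  have s5 : y 1 * (c 0 - c 2) = (1 / 32 : ℝ) • (c 0 - c 2) := swapyc 1 0
  have s6 : c 0 * (c 1 - c 2) = (1 / 32 : ℝ) • (c 1 - c 2) := swapc 0 1
  have s7 : c 1 * (c 0 - c 2) = (1 / 32 : ℝ) • (c 0 - c 2) := swapc 1 0
  have s8 : y 0 * (y 1 - y 2) = (1 / 32 : ℝ) • (y 1 - y 2) := swapy 0 1
  have s9 : y 1 * (y 0 - y 2) = (1 / 32 : ℝ) • (y 0 - y 2) := swapy 1 0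
  simp only [mul_sub, mul_comm (y _) (c _)] at s1 s2 s3 s4 s5 s6 s7 s8 s9
  rw [mul_comm (c 1) (c 0)] at s7
  rw [mul_comm (y 1) (y 0)] at s9
  have e0 := (hc 0).sigma_sub_sigma (c := c 0) (y := y 0) (s := c 1 + c 2) (u := y 1 + y 2)
    (w := w) (k := k) (r := r) (L := F (c 0) (y 1)) hF (hy 0) (hτ 0) (hτ' 0) (hmul 0)
    (hcy 0 0) (by rw [map_add, hcy, hcy, add_comm]; rfl)
    (by rw [map_add, hyc, hyc, add_comm]; rfl) (h0 0)
    (by rw [mul_add]; linear_combination (norm := module) -s1 - (2 : ℝ) • hw)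
    (by rw [mul_add]; linear_combination (norm := module) -s6 - (2 : ℝ) • hk)
    (by rw [mul_add]; linear_combination (norm := module) -s8 - (2 : ℝ) • hr)
    (by
      rw [mul_add, mul_comm (y 0), mul_comm (y 0)]
      linear_combination (norm := module) -(2 : ℝ) • (s1 + s2 + s3 + hw) - s4)
    (by rw [map_add, l02]; ring) (by rw [map_add, hF.symm, hF.symm (y 0), l10, l20]; ring)
  have e1 := (hc 1).sigma_sub_sigma (c := c 1) (y := y 1) (s := c 0 + c 2) (u := y 0 + y 2)
    (w := w) (k := k) (r := r) (L := F (c 0) (y 1)) hF (hy 1) (hτ 1) (hτ' 1) (hmul 1)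
    (hcy 1 1) (by rw [map_add, hcy, hcy, add_comm]; rfl)
    (by rw [map_add, hyc, hyc, add_comm]; rfl) (h0 1)
    (by
      rw [mul_add]
      linear_combination (norm := module) -(2 : ℝ) • (s1 + s2 + hw) - s3)
    (by
      rw [mul_add, mul_comm (c 1) (c 0)]
      linear_combination (norm := module) -s7 - (2 : ℝ) • hk)
    (by
      rw [mul_add, mul_comm (y 1) (y 0)]
      linear_combination (norm := module) -s9 - (2 : ℝ) • hr)
    (by
      rw [mul_add, mul_comm (y 1), mul_comm (y 1)]
      linear_combination (norm := module) -s5 - (2 : ℝ) • hw)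
    (by rw [map_add, l12, l10]; ring) (by rw [map_add, hF.symm, hF.symm (y 1), l21]; ring)
  have fc0 : F (c 0) (y 0) = 0 := by
    rw [← hF.form_self_mul (hc 0).idempotent, h0, map_zero]
  have fc1 : F (c 1) (y 1) = 0 := by
    rw [← hF.form_self_mul (hc 1).idempotent, h0, map_zero]
  have f1 : F (c 0) (c 1 * y 0) = 0 := by
    rw [mul_comm, hF.assoc, h0]; simp
  have f2 := hF.form_self_mul (hc 0).idempotent (y 1)
  have g1 : c 1 * y 0 = w + (1 / 32 : ℝ) • (c 1 + y 0) := by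
    linear_combination (norm := module) -(s1 + s2 + s3 + hw)
  have g2 : c 0 * y 1 = w + (1 / 32 : ℝ) • (c 0 + y 1) := by rw [hw]; module
  rw [g1] at f1
  rw [g2] at f2
  simp only [map_add, map_smul, smul_eq_mul, fc0, (hc 0).length] at f1 f2
  -- From `F (c 0) (c 1 * y 0) = F (c 0 * y 0) (c 1) = 0`, with `F (c 0) w` found from `c 0 * y 1`.
  have hp : F (c 0) (c 1) = 1 - 31 * F (c 0) (y 1) := by linarith
  have hp1 := (hc 0).form_ne_one hF (hc 1) hne
  have h := congrArg (F (c 1)) (e0.symm.trans e1)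
  simp only [map_add, map_sub, map_smul, smul_eq_mul, fc1, (hc 1).length, c12, l12, l10,
    hF.symm (c 1) (c 0)] at h
  -- The two expressions for `k - r`, at indices 0 and 1, are compared by pairing with `c 1`.
  have hL : F (c 0) (y 1) * (24 * F (c 0) (y 1) - 21 / 32) = 0 := by
    rw [hp] at h
    linear_combination (1 / 32 : ℝ) * h
  have hL0 : F (c 0) (y 1) ≠ 0 := fun h' => hp1 (by rw [hp, h']; norm_num)
  have hL' := (mul_eq_zero.1 hL).resolve_left hL0
  -- Now `F (c 0) (y 1) = 7 / 256`, so `F (c 0) (c 1) = 39 / 256`, which is not an admissible value.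
  rcases form_eq_of_dihedral_three hF (hc 0) (hc 1) (hc 2) (hτ 0) (hτ 1) (hτ 2) (hcc 0 1)
    (hcc 0 2) (hcc 1 2) (hcc 1 0) (hcc 2 0) (hcc 2 1) rfl c02 c12 with h | h | h <;> linarith

end DihedralHigher

/-! ### Consequences for the set `T` of a Majorana representation. -/

namespace MajoranaRepresentation

variable {G : Type*} [Group G] {T : Set G} {V : Type*} [NonUnitalNonAssocCommRing V] [Module ℝ V]
  [IsScalarTower ℝ V V] [SMulCommClass ℝ V V]

theorem isMajoranaAxis_ψ (R : MajoranaRepresentation G T V) (t : T) : IsMajoranaAxis R.form (R.ψ t : V) :=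
  R.isMajoranaAxis _ (R.ψ t).2

theorem ψ_injective (R : MajoranaRepresentation G T V) {s t : T} (h : (R.ψ s : V) = R.ψ t) : s = t :=
  R.ψ.injective (Subtype.ext h)

theorem φ_ψ (R : MajoranaRepresentation G T V) (g : G) (s t : T)
    (h : (t : G) = g * s * g⁻¹) : R.φ g (R.ψ s : V) = R.ψ t := by
  rw [← R.ψ_conj]
  congr 2
  exact Subtype.ext h.symm

/-- Distinct commuting involutions in `T` whose product is not in `T` correspond to axes with
product zero. -/
theorem mul_eq_zero_of_commute (R : MajoranaRepresentation G T V)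
    {s t : T} (hst : s ≠ t) (hcomm : Commute (s : G) t)
    (hT : (s : G) * t ∉ T) : (R.ψ s : V) * R.ψ t = 0 := by
  have h1 : R.φ (s : G) (R.ψ t : V) = R.ψ t := R.φ_ψ _ _ _ (by rw [hcomm.eq]; group)
  have h2 : R.φ (t : G) (R.ψ s : V) = R.ψ s := R.φ_ψ _ _ _ (by rw [hcomm.symm.eq]; group)
  refine ((R.isMajoranaAxis_ψ s).mul_eq_zero_or_isDihedral2A R.isMajoranaForm
    (R.isMajoranaAxis_ψ t) (fun h => hst (R.ψ_injective h)) (R.φ_eq_tau s) (R.φ_eq_tau t)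
    h1 h2).resolve_right fun h => hT (R.mul_mem_of_2A s t _ h).1

/-- If the product of two elements of `T` has order six, then its cube lies in `T`. -/
theorem mul_pow_three_mem (R : MajoranaRepresentation G T V)
    {s t : G} (hs : s ∈ T) (ht : t ∈ T) (h6 : orderOf (t * s) = 6) :
    (t * s) ^ 3 ∈ T := by
  by_contra hT
  have hs2 : s * s = 1 := by rw [← sq, ← R.orderOf_eq_two s hs, pow_orderOf_eq_one]
  have ht2 : t * t = 1 := by rw [← sq, ← R.orderOf_eq_two t ht, pow_orderOf_eq_one]
  have hsi : s⁻¹ = s := inv_eq_of_mul_eq_one_right hs2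
  have hti : t⁻¹ = t := inv_eq_of_mul_eq_one_right ht2
  obtain ⟨q, hq⟩ : ∃ q, q = t * s := ⟨_, rfl⟩
  have hsq (n : ℤ) : s * q ^ n = q ^ (-n) * s := by
    have h : s * q * s⁻¹ = q⁻¹ := by
      rw [hq, mul_inv_rev, hsi, hti, mul_assoc, mul_assoc, hs2, mul_one]
    have h' : s * q ^ n * s⁻¹ = q ^ (-n) := by rw [← conj_zpow, h, inv_zpow, zpow_neg]
    rw [← h', hsi, mul_assoc, hs2, mul_one]
  have hq6 : q ^ (6 : ℤ) = 1 := by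
    rw [hq, show (6 : ℤ) = (orderOf (t * s) : ℕ) by rw [h6]; rfl, zpow_natCast,
      pow_orderOf_eq_one]
  have hcong {m n : ℤ} (h : (6 : ℤ) ∣ m - n) : q ^ m = q ^ n := by
    obtain ⟨k, hk⟩ := h
    rw [← mul_inv_eq_one, ← zpow_neg, ← zpow_add, ← sub_eq_add_neg, hk, zpow_mul, hq6, one_zpow]
  have hrefl (m n : ℤ) : (q ^ m * s) * (q ^ n * s) * (q ^ m * s)⁻¹ = q ^ (2 * m - n) * s := by
    rw [mul_inv_rev, hsi, ← zpow_neg, mul_assoc (q ^ m), ← mul_assoc s, hsq, mul_assoc (q ^ (-n)),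
      hs2, mul_one, hsq, ← mul_assoc, ← zpow_add, ← zpow_add]
    congr 2
    ring
  have hmem (n : ℤ) : q ^ n * s ∈ T := by
    rcases Int.even_or_odd' n with ⟨k, rfl | rfl⟩
    · have := R.conj_mem s hs (q ^ k)
      rwa [mul_assoc, ← zpow_neg, hsq, ← mul_assoc, neg_neg, ← zpow_add, ← two_mul] at this
    · have := R.conj_mem t ht (q ^ k)
      have h : t = q ^ (1 : ℤ) * s := by rw [zpow_one, hq, mul_assoc, hs2, mul_one]
      rwa [h, mul_assoc, mul_assoc, ← zpow_neg, hsq, ← mul_assoc, ← mul_assoc, neg_neg, ← zpow_add,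
        ← zpow_add, show k + 1 + k = 2 * k + 1 by ring] at this
  let e (n : ℤ) : T := ⟨q ^ n * s, hmem n⟩
  have he {m n : ℤ} (h : (6 : ℤ) ∣ m - n) : e m = e n :=
    Subtype.ext (congrArg (· * s) (hcong h))
  have hφ (i j k : ℤ) (h : (6 : ℤ) ∣ 2 * i - j - k) :
      R.φ (e i : G) (R.ψ (e j) : V) = R.ψ (e k) := by
    rw [← he h]
    exact R.φ_ψ _ _ _ (hrefl i j).symm
  -- Integer lifts of the indices. The axes are indexed by doubled lifts, so congruences modulo 3
  -- become congruences modulo 6 for exponents of `q`.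
  let z (i : ZMod 3) : ℤ := i.val
  have hz (i j : ZMod 3) : (3 : ℤ) ∣ z i + z j + z (-i - j) := by
    revert i j
    decide
  refine not_mul_eq_zero_of_dihedral_six (F := R.form) (c := fun i => (R.ψ (e (2 * z i)) : V))
    (y := fun i => (R.ψ (e (2 * z i + 3)) : V)) (τ := fun i => R.φ (e (2 * z i) : G))
    (τ' := fun i => R.φ (e (2 * z i + 3) : G)) R.isMajoranaForm
    (fun i => R.isMajoranaAxis_ψ _) (fun i => R.isMajoranaAxis_ψ _) (fun i => R.φ_eq_tau _)
    (fun i => R.φ_eq_tau _) (fun i => R.φ_mul _) (fun i => R.φ_form _)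
    (fun i j => hφ _ _ _ ?_) (fun i j => hφ _ _ _ ?_) (fun i j => hφ _ _ _ ?_)
    (fun i j => hφ _ _ _ ?_) ?_ (fun i => ?_)
  · have := hz i j
    omega
  · have := hz i j
    omega
  · have := hz i j
    omega
  · have := hz i j
    omega
  · intro h
    have h1 : q ^ (0 : ℤ) * s = q ^ (2 : ℤ) * s := congrArg Subtype.val (R.ψ_injective h)
    have h2 : q ^ 2 = 1 := by
      have := mul_right_cancel h1
      rw [zpow_zero] at this
      exact_mod_cast this.symm
    rw [hq] at h2
    have := Nat.le_of_dvd (by norm_num) (orderOf_dvd_of_pow_eq_one h2)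
    omega
  · have hprod (m n : ℤ) : (q ^ m * s) * (q ^ n * s) = q ^ (m - n) := by
      rw [mul_assoc, ← mul_assoc s, hsq, mul_assoc, hs2, mul_one, ← zpow_add, sub_eq_add_neg]
    have h3 : q ^ 3 ≠ 1 := fun h => by
      rw [hq] at h
      have := Nat.le_of_dvd (by norm_num) (orderOf_dvd_of_pow_eq_one h)
      omega
    have hp : (e (2 * z i) : G) * e (2 * z i + 3) = q ^ 3 := by
      rw [← zpow_natCast]
      exact (hprod _ _).trans (hcong (by norm_num))
    have hp' : (e (2 * z i + 3) : G) * e (2 * z i) = q ^ 3 := by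
      rw [← zpow_natCast]
      exact (hprod _ _).trans (hcong (by norm_num))
    refine R.mul_eq_zero_of_commute (fun h => h3 ?_) (hp.trans hp'.symm) (by rwa [hp, hq])
    rw [← hp, ← h, ← sq, ← R.orderOf_eq_two _ (e (2 * z i)).2, pow_orderOf_eq_one]

/-- The involutions of an elementary abelian subgroup of order eight do not all lie in `T`. -/
theorem not_forall_mem_of_elementary_abelian (R : MajoranaRepresentation G T V)
    {x y z : G} (hx : x ∈ T) (hy : y ∈ T) (hz : z ∈ T)
    (hxy : x * y ∈ T) (hxz : x * z ∈ T) (hyz : y * z ∈ T) (hxyz : x * y * z ∈ T) : False := by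
  have hsq {g : G} (hg : g ∈ T) : g * g = 1 := by
    rw [← sq, ← R.orderOf_eq_two g hg, pow_orderOf_eq_one]
  have hinv {g : G} (hg : g ∈ T) : g⁻¹ = g := inv_eq_of_mul_eq_one_right (hsq hg)
  have hcomm {g h : G} (hg : g ∈ T) (hh : h ∈ T) (hgh : g * h ∈ T) : h * g = g * h := by
    rw [← hinv hgh, mul_inv_rev, hinv hg, hinv hh]
  have cxy := hcomm hx hy hxy
  have cxz := hcomm hx hz hxz
  have cyz := hcomm hy hz hyz
  have h2A (g h k : T) (hk : (k : G) = g * h) : IsDihedral2A R.form (R.ψ g : V) (R.ψ h) (R.ψ k) :=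
    R.isDihedral2A g h k (by rw [← hk, hsq k.2])
  have D1 := h2A ⟨x, hx⟩ ⟨y, hy⟩ ⟨x * y, hxy⟩ rfl
  have D2 := h2A ⟨x, hx⟩ ⟨z, hz⟩ ⟨x * z, hxz⟩ rfl
  have D3 := h2A ⟨y, hy⟩ ⟨z, hz⟩ ⟨y * z, hyz⟩ rfl
  have D4 := h2A ⟨y, hy⟩ ⟨x * z, hxz⟩ ⟨x * y * z, hxyz⟩ (by simp only [← mul_assoc, cxy])
  have D5 := h2A ⟨x * y, hxy⟩ ⟨z, hz⟩ ⟨x * y * z, hxyz⟩ rfl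
  have D6 := h2A ⟨x * y, hxy⟩ ⟨x * z, hxz⟩ ⟨y * z, hyz⟩ (by
    change y * z = x * y * (x * z)
    rw [← cxy, mul_assoc, ← mul_assoc x x, hsq hx, one_mul])
  have D7 := h2A ⟨x, hx⟩ ⟨y * z, hyz⟩ ⟨x * y * z, hxyz⟩ (mul_assoc _ _ _)
  have hne : (R.ψ ⟨y * z, hyz⟩ : V) ≠ R.ψ ⟨x * y * z, hxyz⟩ := fun h => by
    have h1 : y * z = x * y * z := congrArg Subtype.val (R.ψ_injective h)
    have h2 : x = 1 := by
      rw [mul_assoc] at h1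
      exact (mul_eq_right.1 h1.symm)
    have := R.orderOf_eq_two x hx
    simp [h2] at this
  have ha := R.isMajoranaAxis_ψ ⟨x, hx⟩
  have hF := R.isMajoranaForm
  generalize R.form = F at *
  have m1 := D1.mul_01
  have m1' := D1.mul_0r
  have m2 := D2.mul_01
  have m2' := D2.mul_0r
  have m3 := D3.mul_01
  have m4 := D4.mul_01
  have m5 := D5.mul_01
  have m6 := D6.mul_01
  have m7 := D7.mul_01
  have m7' := D7.mul_0r
  generalize (R.ψ ⟨x, hx⟩ : V) = a at *
  generalize (R.ψ ⟨y, hy⟩ : V) = b at *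
  generalize (R.ψ ⟨z, hz⟩ : V) = c at *
  generalize (R.ψ ⟨x * y, hxy⟩ : V) = ab at *
  generalize (R.ψ ⟨x * z, hxz⟩ : V) = ac at *
  generalize (R.ψ ⟨y * z, hyz⟩ : V) = bc at *
  generalize (R.ψ ⟨x * y * z, hxyz⟩ : V) = abc at *
  have q1 : a * (b - ab) = (1 / 4 : ℝ) • (b - ab) := by
    rw [mul_sub, m1, m1']; module
  have q2 : a * (c - ac) = (1 / 4 : ℝ) • (c - ac) := by
    rw [mul_sub, m2, m2']; module
  have q3 : a * (bc - abc) = (1 / 4 : ℝ) • (bc - abc) := by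
    rw [mul_sub, m7, m7']; module
  -- The seven 2A relations make this product of 1/4-eigenvectors again a 1/4-eigenvector. The
  -- fusion rule allows it no 1/4-part, so `bc = abc`.
  have hprod : (b - ab) * (c - ac) = (-1 / 4 : ℝ) • (bc - abc) := by
    rw [sub_mul, mul_sub, mul_sub, m3, m4, m5, m6]; module
  have h := ha.mul_same_eigenvalue hF (Or.inr rfl) q1 q2
  rw [hprod, mul_smul_comm, q3, map_smul,
    ha.form_eigenvector_eq_zero hF (by norm_num) q3, smul_zero, zero_smul] at h
  apply hne
  linear_combination (norm := module) (-16 : ℝ) • h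

end MajoranaRepresentation

/-! ### Subgroups generated by three commuting involutions. -/

section ElementaryAbelian

variable {G : Type*} [Group G] {x y z : G}

theorem pow_val_add_of_mul_self_eq_one (hx : x * x = 1) (i j : ZMod 2) :
    x ^ (i + j).val = x ^ i.val * x ^ j.val := by
  have h01 (i : ZMod 2) : i = 0 ∨ i = 1 := by revert i; decide
  have h : (1 + 1 : ZMod 2) = 0 := by decide
  rcases h01 i with rfl | rfl <;> rcases h01 j with rfl | rfl <;> simp [h, hx, ZMod.val_one]

theorem exists_monoidHom_of_commuting_involutions (hx : x * x = 1) (hy : y * y = 1)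
    (hz : z * z = 1) (hxy : Commute x y) (hxz : Commute x z) (hyz : Commute y z) :
    ∃ f : Multiplicative (Fin 3 → ZMod 2) →* G,
      (∀ v : Fin 3 → ZMod 2, f (Multiplicative.ofAdd v) =
        x ^ (v 0).val * y ^ (v 1).val * z ^ (v 2).val) ∧
      f.range = Subgroup.closure {x, y, z} := by
  let f : Multiplicative (Fin 3 → ZMod 2) →* G := MonoidHom.mk'
    (fun v => x ^ (v.toAdd 0).val * y ^ (v.toAdd 1).val * z ^ (v.toAdd 2).val) (by
      intro v w
      simp only [toAdd_mul, Pi.add_apply, pow_val_add_of_mul_self_eq_one hx,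
        pow_val_add_of_mul_self_eq_one hy, pow_val_add_of_mul_self_eq_one hz]
      generalize (v.toAdd 0).val = i, (v.toAdd 1).val = j, (v.toAdd 2).val = k,
        (w.toAdd 0).val = i', (w.toAdd 1).val = j', (w.toAdd 2).val = k'
      have e1 : Commute (x ^ i') (y ^ j) := hxy.pow_pow _ _
      have e2 : Commute (x ^ i') (z ^ k) := hxz.pow_pow _ _
      have e3 : Commute (y ^ j') (z ^ k) := hyz.pow_pow _ _
      calc x ^ i * x ^ i' * (y ^ j * y ^ j') * (z ^ k * z ^ k')
          = x ^ i * (x ^ i' * y ^ j) * (y ^ j' * z ^ k) * z ^ k' := by simp only [mul_assoc]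
        _ = x ^ i * y ^ j * (x ^ i' * z ^ k) * y ^ j' * z ^ k' := by
          rw [e1.eq, e3.eq]; simp only [mul_assoc]
        _ = _ := by rw [e2.eq]; simp only [mul_assoc])
  have hf (v : Fin 3 → ZMod 2) : f (Multiplicative.ofAdd v) =
      x ^ (v 0).val * y ^ (v 1).val * z ^ (v 2).val := rfl
  refine ⟨f, hf, le_antisymm ?_ ?_⟩
  · rintro _ ⟨v, rfl⟩
    have h (g : G) (hg : g ∈ ({x, y, z} : Set G)) : g ∈ Subgroup.closure {x, y, z} :=
      Subgroup.subset_closure hg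
    exact mul_mem (mul_mem (pow_mem (h x (by simp)) _) (pow_mem (h y (by simp)) _))
      (pow_mem (h z (by simp)) _)
  · rw [Subgroup.closure_le]
    rintro _ (rfl | rfl | rfl)
    · exact ⟨Multiplicative.ofAdd ![1, 0, 0], by simp [hf, ZMod.val_one]⟩
    · exact ⟨Multiplicative.ofAdd ![0, 1, 0], by simp [hf, ZMod.val_one]⟩
    · exact ⟨Multiplicative.ofAdd ![0, 0, 1], by simp [hf, ZMod.val_one]⟩

theorem mem_closure_of_commuting_involutions (hx : x * x = 1) (hy : y * y = 1)
    (hz : z * z = 1) (hxy : Commute x y) (hxz : Commute x z) (hyz : Commute y z) {g : G}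
    (hg : g ∈ Subgroup.closure {x, y, z}) :
    g = 1 ∨ g = x ∨ g = y ∨ g = z ∨ g = x * y ∨ g = x * z ∨ g = y * z ∨ g = x * y * z := by
  obtain ⟨f, hf, hr⟩ := exists_monoidHom_of_commuting_involutions hx hy hz hxy hxz hyz
  rw [← hr] at hg
  obtain ⟨v, rfl⟩ := hg
  rw [← ofAdd_toAdd v, hf]
  have h01 (i : ZMod 2) : i = 0 ∨ i = 1 := by revert i; decide
  rcases h01 (v.toAdd 0) with h0 | h0 <;> rcases h01 (v.toAdd 1) with h1 | h1 <;>
    rcases h01 (v.toAdd 2) with h2 | h2 <;> simp [h0, h1, h2, ZMod.val_one]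

theorem nonempty_mulEquiv_of_commuting_involutions (hx : x * x = 1) (hy : y * y = 1)
    (hz : z * z = 1) (hxy : Commute x y) (hxz : Commute x z) (hyz : Commute y z)
    (hx1 : x ≠ 1) (hy1 : y ≠ 1) (hz1 : z ≠ 1) (hxy1 : x * y ≠ 1) (hxz1 : x * z ≠ 1)
    (hyz1 : y * z ≠ 1) (hxyz1 : x * y * z ≠ 1) :
    Nonempty (Subgroup.closure ({x, y, z} : Set G) ≃* Multiplicative (Fin 3 → ZMod 2)) := by
  obtain ⟨f, hf, hr⟩ := exists_monoidHom_of_commuting_involutions hx hy hz hxy hxz hyz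
  have hinj : Function.Injective f := by
    rw [injective_iff_map_eq_one]
    intro v hv
    rw [← ofAdd_toAdd v, hf] at hv
    have h01 (i : ZMod 2) : i = 0 ∨ i = 1 := by revert i; decide
    have h : v.toAdd = 0 := by
      rcases h01 (v.toAdd 0) with h0 | h0 <;> rcases h01 (v.toAdd 1) with h1 | h1 <;>
        rcases h01 (v.toAdd 2) with h2 | h2 <;> simp_all [ZMod.val_one]
      ext i
      fin_cases i <;> simp [h0, h1, h2]
    exact h
  exact ⟨((f.ofInjective hinj).trans (MulEquiv.subgroupCongr hr)).symm⟩

end ElementaryAbelian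

/-! ### The possible coordinates of the generators in S₃. -/

section Coordinates

open Equiv

set_option synthInstance.maxHeartbeats 400000 in
set_option synthInstance.maxSize 1000 in
-- Commuting elements `a`, `b` of order at most two lie in a common subgroup of order two. The
-- trivial centralizer forces `c` to be a transposition outside it and exactly one of `b`, `a`, `a *
-- b` to be trivial; these are the types `t = 0, 1, 2`. In each type one of `a * c`, `b * c`, `a * b
-- * c` is `c`, and the other two are 3-cycles.
theorem perm_three_coordinate_type : ∀ a b c : Perm (Fin 3), a * a = 1 → b * b = 1 → c * c = 1 →
    a * b = b * a → (∀ z : Perm (Fin 3), z * a = a * z → z * b = b * z → z * c = c * z → z = 1) →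
    ∃ t : Fin 3, (Perm.sign a = ![-1, 1, -1] t ∧ Perm.sign b = ![1, -1, -1] t ∧
      Perm.sign c = -1) ∧
      ((a * c) ^ 3 = ![1, c, 1] t ∧ (b * c) ^ 3 = ![c, 1, 1] t ∧ (a * b * c) ^ 3 = ![1, 1, c] t) ∧
      ((a * c) ^ 2 = 1 → t = 1) ∧ ((b * c) ^ 2 = 1 → t = 0) ∧ ((a * b * c) ^ 2 = 1 → t = 2) ∧
      (∃ u, u * (a * b) * u⁻¹ = (a * c) ^ 3 * (b * c) ^ 3) ∧
      (∃ u, u * b * u⁻¹ = (a * c) ^ 3 * (a * b * c) ^ 3) ∧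
      (∃ u, u * a * u⁻¹ = (b * c) ^ 3 * (a * b * c) ^ 3) := by
  decide +kernel

end Coordinates

/-! ### Relations in the triangle-point group. -/

section TrianglePoint

open Equiv

theorem orderOf_eq_six_of_cube {G : Type*} [Group G] {g : G} (h2 : g ^ 2 ≠ 1) (h3 : g ^ 3 ≠ 1)
    (h6 : g ^ 3 * g ^ 3 = 1) : orderOf g = 6 := by
  rw [← pow_add] at h6
  refine orderOf_eq_of_pow_and_pow_div_prime (by norm_num) h6 fun p hp hd => ?_
  have hp' : p = 2 ∨ p = 3 := by
    have := Nat.le_of_dvd (by norm_num) hd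
    interval_cases p <;> first | omega | (norm_num at hp)
  rcases hp' with rfl | rfl
  · exact h3
  · exact h2

/-- The relations in a triangle-point group isomorphic to `S₃ × S₃ × S₃`. -/
theorem IsTrianglePointGroup.relations {G : Type*} [Group G]
    (e : G ≃* Perm (Fin 3) × Perm (Fin 3) × Perm (Fin 3)) {a b c : G}
    (h : IsTrianglePointGroup a b c) :
    (orderOf (a * c) = 6 ∧ orderOf (b * c) = 6 ∧ orderOf (a * b * c) = 6) ∧
    (Commute ((a * c) ^ 3) ((b * c) ^ 3) ∧ Commute ((a * c) ^ 3) ((a * b * c) ^ 3) ∧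
      Commute ((b * c) ^ 3) ((a * b * c) ^ 3)) ∧
    (a * c) ^ 3 * (b * c) ^ 3 * (a * b * c) ^ 3 = c ∧
    (∃ g, g * (a * b) * g⁻¹ = (a * c) ^ 3 * (b * c) ^ 3) ∧
    (∃ g, g * b * g⁻¹ = (a * c) ^ 3 * (a * b * c) ^ 3) ∧
    (∃ g, g * a * g⁻¹ = (b * c) ^ 3 * (a * b * c) ^ 3) := by
  obtain ⟨π, hinj, hsurj⟩ : ∃ π : Fin 3 → G →* Perm (Fin 3),
      (∀ g g' : G, (∀ i, π i g = π i g') → g = g') ∧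
      (∀ f : Fin 3 → Perm (Fin 3), ∃ g, ∀ i, π i g = f i) := by
    refine ⟨![(MonoidHom.fst _ _).comp e.toMonoidHom,
      ((MonoidHom.fst _ _).comp (MonoidHom.snd _ _)).comp e.toMonoidHom,
      ((MonoidHom.snd _ _).comp (MonoidHom.snd _ _)).comp e.toMonoidHom], fun g g' hg => ?_,
      fun f => ⟨e.symm (f 0, f 1, f 2), fun i => ?_⟩⟩
    · exact e.injective (Prod.ext (hg 0) (Prod.ext (hg 1) (hg 2)))
    · fin_cases i <;> simp
  have ha : a * a = 1 := by rw [← sq, ← h.orderOf_a, pow_orderOf_eq_one]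
  have hb : b * b = 1 := by rw [← sq, ← h.orderOf_b, pow_orderOf_eq_one]
  have hc : c * c = 1 := by rw [← sq, ← h.orderOf_c, pow_orderOf_eq_one]
  have hab : a * b * (a * b) = 1 := by rw [← sq, ← h.orderOf_ab, pow_orderOf_eq_one]
  have hcomm : a * b = b * a := by
    rw [← inv_eq_of_mul_eq_one_right hab, mul_inv_rev, inv_eq_of_mul_eq_one_right ha,
      inv_eq_of_mul_eq_one_right hb]
  have hgen (H : Subgroup G) (h1 : a ∈ H) (h2 : b ∈ H) (h3 : c ∈ H) (g : G) : g ∈ H := by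
    have hle : Subgroup.closure {a, b, c} ≤ H := by
      rw [Subgroup.closure_le]
      rintro _ (rfl | rfl | rfl) <;> assumption
    rw [h.generate] at hle
    exact hle trivial
  -- Each coordinate map is onto and S₃ has trivial centre, which excludes degenerate coordinates.
  have hcent (i : Fin 3) (z : Perm (Fin 3)) (h1 : z * π i a = π i a * z)
      (h2 : z * π i b = π i b * z) (h3 : z * π i c = π i c * z) : z = 1 := by
    have hz (p : Perm (Fin 3)) : z * p = p * z := by
      obtain ⟨g, hg⟩ := hsurj fun _ => p
      have hmem := hgen ((Subgroup.centralizer {z}).comap (π i))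
        (Subgroup.mem_centralizer_singleton_iff.2 h1.symm)
        (Subgroup.mem_centralizer_singleton_iff.2 h2.symm)
        (Subgroup.mem_centralizer_singleton_iff.2 h3.symm) g
      rw [← hg i]
      exact (Subgroup.mem_centralizer_singleton_iff.1 hmem).symm
    clear h1 h2 h3
    revert z
    decide
  have htype (i : Fin 3) := perm_three_coordinate_type (π i a) (π i b) (π i c)
    (by rw [← map_mul, ha, map_one]) (by rw [← map_mul, hb, map_one])
    (by rw [← map_mul, hc, map_one]) (by rw [← map_mul, hcomm, map_mul]) (hcent i)
  choose t hsign hcube hac hbc habc hu hv hw using htype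
  choose u hu using hu
  choose v hv using hv
  choose w hw using hw
  -- Coordinates of equal type have equal signs on the generators, hence on all of `G`; but the
  -- coordinates of an element can be chosen independently.
  have htinj : Function.Injective t := by
    intro i j hij
    by_contra hne
    have key := hgen ((Perm.sign.comp (π i)).eqLocus (Perm.sign.comp (π j)))
      (by change Perm.sign (π i a) = Perm.sign (π j a); rw [(hsign i).1, (hsign j).1, hij])
      (by change Perm.sign (π i b) = Perm.sign (π j b); rw [(hsign i).2.1, (hsign j).2.1, hij])
      (by change Perm.sign (π i c) = Perm.sign (π j c); rw [(hsign i).2.2, (hsign j).2.2])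
    obtain ⟨g, hg⟩ := hsurj fun k => if k = i then swap 0 1 else 1
    have h1 : Perm.sign (π i g) = Perm.sign (π j g) := key g
    rw [hg, hg, if_pos rfl, if_neg (Ne.symm hne)] at h1
    revert h1
    decide
  have htsurj : Function.Surjective t := Finite.surjective_of_injective htinj
  obtain ⟨i0, h0⟩ := htsurj 0
  obtain ⟨i1, h1⟩ := htsurj 1
  obtain ⟨i2, h2⟩ := htsurj 2
  have hπc (i : Fin 3) : π i c ≠ 1 := fun hi => by
    have := (hsign i).2.2
    rw [hi] at this
    revert this
    decide
  have hπcc (i : Fin 3) : π i c * π i c = 1 := by rw [← map_mul, hc, map_one]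
  have hcases (i : Fin 3) : t i = 0 ∨ t i = 1 ∨ t i = 2 := by
    generalize t i = k
    revert k
    decide
  simp only [← map_mul, ← map_pow] at hcube hac hbc habc hu hv hw
  refine ⟨⟨?_, ?_, ?_⟩, ⟨?_, ?_, ?_⟩, ?_, ?_, ?_, ?_⟩
  · refine orderOf_eq_six_of_cube (fun hh => ?_) (fun hh => ?_) (hinj _ _ fun i => ?_)
    · have := hac i0 (by rw [hh, map_one])
      simp [h0] at this
    · have := (hcube i1).1
      rw [hh, map_one, h1] at this
      exact hπc i1 this.symm
    · rw [map_mul, (hcube i).1, map_one]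
      rcases hcases i with hi | hi | hi <;> simp [hi, hπcc]
  · refine orderOf_eq_six_of_cube (fun hh => ?_) (fun hh => ?_) (hinj _ _ fun i => ?_)
    · have := hbc i1 (by rw [hh, map_one])
      simp [h1] at this
    · have := (hcube i0).2.1
      rw [hh, map_one, h0] at this
      exact hπc i0 this.symm
    · rw [map_mul, (hcube i).2.1, map_one]
      rcases hcases i with hi | hi | hi <;> simp [hi, hπcc]
  · refine orderOf_eq_six_of_cube (fun hh => ?_) (fun hh => ?_) (hinj _ _ fun i => ?_)
    · have := habc i0 (by rw [hh, map_one])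
      simp [h0] at this
    · have := (hcube i2).2.2
      rw [hh, map_one, h2] at this
      exact hπc i2 this.symm
    · rw [map_mul, (hcube i).2.2, map_one]
      rcases hcases i with hi | hi | hi <;> simp [hi, hπcc]
  · refine hinj _ _ fun i => ?_
    rw [map_mul, map_mul, (hcube i).1, (hcube i).2.1]
    rcases hcases i with hi | hi | hi <;> simp [hi]
  · refine hinj _ _ fun i => ?_
    rw [map_mul, map_mul, (hcube i).1, (hcube i).2.2]
    rcases hcases i with hi | hi | hi <;> simp [hi]
  · refine hinj _ _ fun i => ?_
    rw [map_mul, map_mul, (hcube i).2.1, (hcube i).2.2]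
    rcases hcases i with hi | hi | hi <;> simp [hi]
  · refine hinj _ _ fun i => ?_
    rw [map_mul, map_mul, (hcube i).1, (hcube i).2.1, (hcube i).2.2]
    rcases hcases i with hi | hi | hi <;> simp [hi]
  · obtain ⟨g, hg⟩ := hsurj u
    refine ⟨g, hinj _ _ fun i => ?_⟩
    rw [map_mul, map_mul, map_inv, hg, hu]
  · obtain ⟨g, hg⟩ := hsurj v
    refine ⟨g, hinj _ _ fun i => ?_⟩
    rw [map_mul, map_mul, map_inv, hg, hv]
  · obtain ⟨g, hg⟩ := hsurj w
    refine ⟨g, hinj _ _ fun i => ?_⟩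
    rw [map_mul, map_mul, map_inv, hg, hw]

end TrianglePoint

/-! ### The subgroup `K` and the proposition. -/

theorem mainTheorem10 {G : Type*} [Group G]
    (hG : Nonempty
      (G ≃* Equiv.Perm (Fin 3) × Equiv.Perm (Fin 3) × Equiv.Perm (Fin 3)))
    (a b c : G) (habc : IsTrianglePointGroup a b c) :
    (∀ T : Set G, a ∈ T → b ∈ T → c ∈ T → a * b ∈ T →
      ∀ (V : Type*) [NonUnitalNonAssocCommRing V] [Module ℝ V] [IsScalarTower ℝ V V]
        [SMulCommClass ℝ V V], IsEmpty (MajoranaRepresentation G T V)) ∧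
    Nonempty (Subgroup.closure ({(a * c) ^ 3, (b * c) ^ 3, (a * b * c) ^ 3} : Set G) ≃*
      Multiplicative (Fin 3 → ZMod 2)) ∧
    (∀ T : Set G, a ∈ T → b ∈ T → c ∈ T → a * b ∈ T →
      (∀ t ∈ T, ∀ g : G, g * t * g⁻¹ ∈ T) →
      (∀ t ∈ T, ∀ s ∈ T, orderOf (t * s) = 6 → (t * s) ^ 3 ∈ T) →
      (Subgroup.closure ({(a * c) ^ 3, (b * c) ^ 3, (a * b * c) ^ 3} : Set G) : Set G) ⊆
        T ∪ {1}) := by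
  obtain ⟨e⟩ := hG
  obtain ⟨⟨o1, o2, o3⟩, ⟨c1, c2, c3⟩, hxyz, ⟨u, hu⟩, ⟨v, hv⟩, ⟨w, hw⟩⟩ := habc.relations e
  have hcube {g : G} (hg : orderOf g = 6) : g ^ 3 * g ^ 3 = 1 ∧ g ^ 3 ≠ 1 := by
    refine ⟨by rw [← pow_add, ← pow_orderOf_eq_one g, hg], fun h => ?_⟩
    have := Nat.le_of_dvd (by norm_num) (orderOf_dvd_of_pow_eq_one h)
    omega
  have hne {g : G} (hg : orderOf g = 2) (u : G) : u * g * u⁻¹ ≠ 1 := by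
    rw [Ne, conj_eq_one_iff]
    rintro rfl
    simp at hg
  -- Only closure under conjugation and under cubes of products of order six is needed, so this
  -- serves both the first and the third claim.
  have hmem (T : Set G) (ha : a ∈ T) (hb : b ∈ T) (hc : c ∈ T) (hab : a * b ∈ T)
      (hconj : ∀ t ∈ T, ∀ g : G, g * t * g⁻¹ ∈ T)
      (h6 : ∀ t ∈ T, ∀ s ∈ T, orderOf (t * s) = 6 → (t * s) ^ 3 ∈ T) :
      ((a * c) ^ 3 ∈ T ∧ (b * c) ^ 3 ∈ T ∧ (a * b * c) ^ 3 ∈ T) ∧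
      (a * c) ^ 3 * (b * c) ^ 3 ∈ T ∧ (a * c) ^ 3 * (a * b * c) ^ 3 ∈ T ∧
      (b * c) ^ 3 * (a * b * c) ^ 3 ∈ T ∧ (a * c) ^ 3 * (b * c) ^ 3 * (a * b * c) ^ 3 ∈ T :=
    ⟨⟨h6 a ha c hc o1, h6 b hb c hc o2, h6 _ hab c hc o3⟩, hu ▸ hconj _ hab u,
      hv ▸ hconj _ hb v, hw ▸ hconj _ ha w, hxyz.symm ▸ hc⟩
  refine ⟨fun T ha hb hc hab V _ _ _ _ => ⟨fun R => ?_⟩, ?_, ?_⟩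
  · obtain ⟨⟨h1, h2, h3⟩, h4, h5, h6, h7⟩ := hmem T ha hb hc hab R.conj_mem
      fun t ht s hs h => R.mul_pow_three_mem hs ht h
    exact R.not_forall_mem_of_elementary_abelian h1 h2 h3 h4 h5 h6 h7
  · refine nonempty_mulEquiv_of_commuting_involutions (hcube o1).1 (hcube o2).1 (hcube o3).1
      c1 c2 c3 (hcube o1).2 (hcube o2).2 (hcube o3).2 (hu ▸ hne habc.orderOf_ab u)
      (hv ▸ hne habc.orderOf_b v) (hw ▸ hne habc.orderOf_a w) ?_
    rw [hxyz]
    simpa using hne habc.orderOf_c 1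
  · intro T ha hb hc hab hconj h6 g hg
    obtain ⟨⟨h1, h2, h3⟩, h4, h5, h6, h7⟩ := hmem T ha hb hc hab hconj h6
    rcases mem_closure_of_commuting_involutions (hcube o1).1 (hcube o2).1 (hcube o3).1 c1 c2 c3 hg
      with rfl | rfl | rfl | rfl | rfl | rfl | rfl | rfl
    · exact Or.inr rfl
    all_goals exact Or.inl ‹_›
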